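/- For a prime $p$ and integers $b,c$, let $D_p(b,c)=\det\left[(i^2+bij+cj^2)^{p-2}\right]_{1\le i,j\le p-1}$ (an integer), and let $\left(\frac{\cdot}{p}\right)$ denote the Legendre symbol. Then for every prime $p$ with $p\equiv 1\pmod 4$ and $p\equiv\pm2\pmod 5$, one has $$\left(\frac{D_p(1,-1)}{p}\right)=1.$$ -/

import Mathlib

/-- The determinant `D_p(b,c) = |(i² + b i j + c j²)^(p-2)|` with `1 ≤ i, j ≤ p - 1`, an integer.
The index `i : Fin (p - 1)` stands for the integer `i + 1 ∈ {1, …, p - 1}`. -/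
def sunDet (p : ℕ) (b c : ℤ) : ℤ :=
  Matrix.det (Matrix.of fun i j : Fin (p - 1) =>
    (((i : ℤ) + 1) ^ 2 + b * ((i : ℤ) + 1) * ((j : ℤ) + 1) + c * ((j : ℤ) + 1) ^ 2) ^ (p - 2))

/-! Modulo `p`, 5 is a non-square, so `i² + ij - j²` never vanishes for `j ≠ 0` and its power `p -
2` is its inverse. The roots of `X² + X - 1` are swapped by Frobenius, so two geometric sums expand
this inverse in powers of `j / i` with coefficients `V_k / 5`, where `V_k = α^k + β^k`
(`sum_companionSeq_mul_quadForm`). The matrix thus factors through Vandermonde-type and diagonal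
matrices, and the determinant is `V_1 ⋯ V_(p-1)` times a nonzero square (`sunDet_one_neg_one_cast`).
That product is nonzero (`companionSeq_ne_zero`), and it is a square by the symmetry `k ↦ p + 1 - k`
(`isSquare_prod_companionSeq`). -/

/-- The companion Lucas sequence of `X ^ 2 + X - 1`. -/
def companionSeq (R : Type*) [CommRing R] : ℕ → R
  | 0 => 2
  | 1 => -1
  | n + 2 => companionSeq R n - companionSeq R (n + 1)

theorem companionSeq_eq_pow_add_pow {R : Type*} [CommRing R] {α β : R} (hs : α + β = -1)
    (hm : α * β = -1) (n : ℕ) : companionSeq R n = α ^ n + β ^ n := by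
  induction n using Nat.twoStepInduction with
  | zero => simp [companionSeq]; norm_num
  | one => simp [companionSeq, hs]
  | more n h1 h2 =>
    rw [companionSeq, h1, h2]
    linear_combination (-α ^ (n + 1) - β ^ (n + 1)) * hs + (α ^ n + β ^ n) * hm

theorem map_companionSeq {R S : Type*} [CommRing R] [CommRing S] (f : R →+* S) (n : ℕ) :
    f (companionSeq R n) = companionSeq S n := by
  induction n using Nat.twoStepInduction with
  | zero => exact map_ofNat f 2
  | one => simp [companionSeq]
  | more n h1 h2 => simp [companionSeq, h1, h2]

theorem Finset.prod_range_two_mul_add_one {M : Type*} [CommMonoid M] (f : ℕ → M) (n : ℕ) :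
    ∏ k ∈ Finset.range (2 * n + 1), f k = (∏ k ∈ Finset.range n, f k * f (2 * n - k)) * f n := by
  rw [show 2 * n + 1 = n + (n + 1) by ring, Finset.prod_range_add, Finset.prod_range_succ',
    Finset.prod_mul_distrib, ← mul_assoc]
  congr 2
  rw [← Finset.prod_range_reflect]
  refine Finset.prod_congr rfl fun k hk => ?_
  rw [Finset.mem_range] at hk
  congr 1
  omega

theorem isSquare_finset_prod {ι M : Type*} [CommMonoid M] {s : Finset ι} {f : ι → M}
    (h : ∀ i ∈ s, IsSquare (f i)) : IsSquare (∏ i ∈ s, f i) :=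
  Finset.prod_induction f IsSquare (fun _ _ => IsSquare.mul) IsSquare.one h

section GeometricSums

variable {p : ℕ} [Fact p.Prime]

theorem sum_pow_succ_mul_sub_one {R : Type*} [CommRing R] (v : R) :
    (∑ k : Fin (p - 1), v ^ ((k : ℕ) + 1)) * (v - 1) = v ^ p - v := by
  have hp : p - 1 + 1 = p := Nat.succ_pred_prime Fact.out
  rw [Fin.sum_univ_eq_sum_range (fun k => v ^ (k + 1)) (p - 1)]
  simp_rw [pow_succ v, ← Finset.sum_mul]
  have h := geom_sum_mul v (p - 1)
  rw [mul_right_comm, h, sub_mul, one_mul, ← pow_succ, hp]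

theorem ZMod.sum_pow_succ (u : ZMod p) :
    ∑ k : Fin (p - 1), u ^ ((k : ℕ) + 1) = if u = 1 then -1 else 0 := by
  have hp : 1 ≤ p := (Fact.out : p.Prime).one_lt.le
  split_ifs with h
  · simp [h, Nat.cast_sub hp]
  · have h1 := sum_pow_succ_mul_sub_one (p := p) u
    rw [ZMod.pow_card, sub_self] at h1
    exact (mul_eq_zero.mp h1).resolve_right (sub_ne_zero.mpr h)

end GeometricSums

/-! ### Conjugate roots over `ZMod p` and the values `V_k`. -/

section Roots

variable {p : ℕ} [Fact p.Prime]

theorem ZMod.not_isSquare_five (h4 : p % 4 = 1) (h5 : p % 5 = 2 ∨ p % 5 = 3) :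
    ¬ IsSquare (5 : ZMod p) := by
  have h2 : ∀ x : ZMod 5, 2 ≠ x * x := by decide
  have h3 : ∀ x : ZMod 5, 3 ≠ x * x := by decide
  have : Fact (Nat.Prime 5) := ⟨by norm_num⟩
  have h := (ZMod.exists_sq_eq_prime_iff_of_mod_four_eq_one (p := p) (q := 5) h4 (by norm_num))
  push_cast at h
  rw [h, ← ZMod.natCast_mod]
  rcases h5 with h5 | h5 <;> rw [h5]
  · exact fun ⟨x, hx⟩ => h2 x hx
  · exact fun ⟨x, hx⟩ => h3 x hx

/-- In an extension field of `ZMod p`, the roots of `X ^ 2 + X - 1` are interchanged by Frobenius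
as soon as `5` is not a square modulo `p`. -/
theorem exists_conjugate_roots (hp2 : p ≠ 2) (h5 : ¬ IsSquare (5 : ZMod p)) :
    ∃ α β : AlgebraicClosure (ZMod p),
      α + β = -1 ∧ α * β = -1 ∧ α ^ p = β ∧ β ^ p = α := by
  have h50 : (5 : ZMod p) ≠ 0 := fun h => h5 (h ▸ IsSquare.zero)
  have h20 : (2 : ZMod p) ≠ 0 := by
    have : NeZero p := ⟨(Fact.out : p.Prime).ne_zero⟩
    exact Ring.two_ne_zero (by rwa [ZMod.ringChar_zmod_n])
  let K := AlgebraicClosure (ZMod p)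
  have h2K : (2 : K) ≠ 0 := by
    have := (map_ne_zero (algebraMap (ZMod p) K)).mpr h20
    rwa [map_ofNat] at this
  obtain ⟨δ, hδ⟩ := IsAlgClosed.exists_pow_nat_eq (5 : K) (n := 2) (by norm_num)
  have hodd : 2 * (p / 2) + 1 = p := by
    have := (Fact.out : p.Prime).eq_two_or_odd
    omega
  have hδp : δ ^ p = -δ := by
    have he : (5 : ZMod p) ^ (p / 2) = -1 := by
      refine (ZMod.pow_div_two_eq_neg_one_or_one p h50).resolve_left fun h => h5 ?_
      exact (ZMod.euler_criterion p h50).mpr h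
    have heK : (5 : K) ^ (p / 2) = -1 := by
      have := congrArg (algebraMap (ZMod p) K) he
      rwa [map_pow, map_ofNat, map_neg, map_one] at this
    rw [← congrArg (δ ^ ·) hodd]
    rw [pow_succ, pow_mul, hδ, heK, neg_one_mul]
  have h2p : (2 : K) ^ p = 2 := by
    have := congrArg (algebraMap (ZMod p) K) (ZMod.pow_card (2 : ZMod p))
    rwa [map_pow, map_ofNat] at this
  have hnp : (-1 : K) ^ p = -1 := by
    have := congrArg (algebraMap (ZMod p) K) (ZMod.pow_card (-1 : ZMod p))
    rwa [map_pow, map_neg, map_one] at this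
  refine ⟨(-1 + δ) / 2, (-1 - δ) / 2, ?_, ?_, ?_, ?_⟩
  · field_simp; ring
  · field_simp; linear_combination -hδ
  · rw [div_pow, add_pow_char, h2p, hnp, hδp, sub_eq_add_neg]
  · rw [div_pow, sub_pow_char, h2p, hnp, hδp, sub_neg_eq_add]

theorem sub_sq_eq_five {R : Type*} [CommRing R] {α β : R} (hs : α + β = -1) (hm : α * β = -1) :
    (β - α) ^ 2 = 5 := by
  linear_combination (α + β - 1) * hs - 4 * hm

/-- Completing the square: `4(i² + ij - j²) = (2i + j)² - 5j²`. -/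
theorem quadForm_ne_zero (h5 : ¬ IsSquare (5 : ZMod p)) {i j : ZMod p} (hj : j ≠ 0) :
    i ^ 2 + i * j - j ^ 2 ≠ 0 := fun h => h5 ⟨2 * i / j + 1, by
  field_simp
  linear_combination -4 * h⟩

/-- With `u = j / i`, Frobenius makes the sum of `(uα)^k` equal to `u(β - α) / (uα - 1)`, and
symmetrically for `β`. Adding the two gives `u²(β - α)²` over `(uα - 1)(uβ - 1) = 1 + u - u²`. -/
theorem sum_companionSeq_mul_quadForm (hp2 : p ≠ 2) (h5 : ¬ IsSquare (5 : ZMod p))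
    {i : ZMod p} (hi : i ≠ 0) (j : ZMod p) :
    (∑ k : Fin (p - 1), (j / i) ^ ((k : ℕ) + 1) * companionSeq (ZMod p) (k + 1)) *
      (i ^ 2 + i * j - j ^ 2) = 5 * j ^ 2 := by
  obtain ⟨α, β, hs, hm, hα, hβ⟩ := exists_conjugate_roots hp2 h5
  obtain ⟨u, rfl⟩ : ∃ u, j = u * i := ⟨j / i, by field_simp⟩
  rw [mul_div_cancel_right₀ _ hi]
  let φ := algebraMap (ZMod p) (AlgebraicClosure (ZMod p))
  apply φ.injective
  have hu : φ u ^ p = φ u := by rw [← map_pow, ZMod.pow_card]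
  have h1 := sum_pow_succ_mul_sub_one (p := p) (φ u * α)
  have h2 := sum_pow_succ_mul_sub_one (p := p) (φ u * β)
  rw [mul_pow, hu, hα] at h1
  rw [mul_pow, hu, hβ] at h2
  have hsum : φ (∑ k : Fin (p - 1), u ^ ((k : ℕ) + 1) * companionSeq (ZMod p) (k + 1)) =
      (∑ k : Fin (p - 1), (φ u * α) ^ ((k : ℕ) + 1)) +
        ∑ k : Fin (p - 1), (φ u * β) ^ ((k : ℕ) + 1) := by
    rw [map_sum, ← Finset.sum_add_distrib]
    refine Finset.sum_congr rfl fun k _ => ?_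
    rw [map_mul, map_pow, map_companionSeq, companionSeq_eq_pow_add_pow hs hm, mul_pow, mul_pow,
      mul_add]
  have hd := sub_sq_eq_five hs hm
  rw [map_mul, hsum]
  simp only [map_sub, map_add, map_mul, map_pow, map_ofNat]
  generalize (∑ k : Fin (p - 1), (φ u * α) ^ ((k : ℕ) + 1)) = S at *
  generalize (∑ k : Fin (p - 1), (φ u * β) ^ ((k : ℕ) + 1)) = T at *
  have hfac : 1 + φ u - φ u ^ 2 = (φ u * α - 1) * (φ u * β - 1) := by
    linear_combination φ u * hs - φ u ^ 2 * hm
  calc (S + T) * (φ i ^ 2 + φ i * (φ u * φ i) - (φ u * φ i) ^ 2)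
      = φ i ^ 2 * ((S + T) * (1 + φ u - φ u ^ 2)) := by ring
    _ = 5 * (φ u * φ i) ^ 2 := by
      rw [hfac]
      linear_combination φ i ^ 2 * (φ u * β - 1) * h1 + φ i ^ 2 * (φ u * α - 1) * h2 +
        φ i ^ 2 * φ u ^ 2 * hd

theorem root_pow_card_add_one {α β : AlgebraicClosure (ZMod p)} (hm : α * β = -1)
    (hα : α ^ p = β) : α ^ (p + 1) = -1 := by
  rw [pow_succ, hα, mul_comm, hm]

/-- A zero would give `(-α²)^k = -1`, but `-α²` has odd order, dividing `(p + 1) / 2`. -/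
theorem companionSeq_ne_zero (h4 : p % 4 = 1) (h5 : ¬ IsSquare (5 : ZMod p)) (k : ℕ) :
    companionSeq (ZMod p) k ≠ 0 := by
  intro h
  have hp2 : p ≠ 2 := by omega
  obtain ⟨α, β, hs, hm, hα, hβ⟩ := exists_conjugate_roots hp2 h5
  have h0 := congrArg (algebraMap (ZMod p) (AlgebraicClosure (ZMod p))) h
  rw [map_zero, map_companionSeq, companionSeq_eq_pow_add_pow hs hm] at h0
  obtain ⟨t, ht⟩ : ∃ t, p = 4 * t + 1 := ⟨p / 4, by omega⟩
  have hodd : Odd (2 * t + 1) := ⟨t, rfl⟩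
  have h1 : (-α ^ 2) ^ k = -1 := by
    have hab : α ^ k * β ^ k = (-1) ^ k := by rw [← mul_pow, hm]
    have hone : ((-1 : AlgebraicClosure (ZMod p)) ^ k) * (-1) ^ k = 1 := by
      rw [← mul_pow]; simp
    rw [neg_pow, ← pow_mul, mul_comm 2 k, pow_mul]
    linear_combination (-1) ^ k * α ^ k * h0 - (-1) ^ k * hab - hone
  have h2 : (-α ^ 2) ^ (2 * t + 1) = 1 := by
    have := root_pow_card_add_one hm hα
    rw [show p + 1 = 2 * (2 * t + 1) by omega, pow_mul] at this
    rw [hodd.neg_pow, this, neg_neg]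
  have h3 : (1 : AlgebraicClosure (ZMod p)) = -1 := by
    calc (1 : AlgebraicClosure (ZMod p)) = ((-α ^ 2) ^ (2 * t + 1)) ^ k := by rw [h2, one_pow]
      _ = ((-α ^ 2) ^ k) ^ (2 * t + 1) := by rw [← pow_mul, mul_comm, pow_mul]
      _ = -1 := by rw [h1, hodd.neg_one_pow]
  have h4' : algebraMap (ZMod p) (AlgebraicClosure (ZMod p)) 1 =
      algebraMap (ZMod p) (AlgebraicClosure (ZMod p)) (-1) := by
    rw [map_neg, map_one]; exact h3
  have : Fact (2 < p) := ⟨by have := (Fact.out : p.Prime).two_le; omega⟩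
  exact ZMod.neg_one_ne_one ((algebraMap (ZMod p) (AlgebraicClosure (ZMod p))).injective h4').symm

/-- From `α^(p+1) = -1` and `αβ = -1`, `α^l = -α^(-k) = -(-1)^k β^k`, and likewise with the roots
exchanged. -/
theorem companionSeq_reflect (hp2 : p ≠ 2) (h5 : ¬ IsSquare (5 : ZMod p)) {k l : ℕ}
    (hkl : k + l = p + 1) :
    companionSeq (ZMod p) l = -(-1) ^ k * companionSeq (ZMod p) k := by
  obtain ⟨α, β, hs, hm, hα, hβ⟩ := exists_conjugate_roots hp2 h5
  apply (algebraMap (ZMod p) (AlgebraicClosure (ZMod p))).injective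
  rw [map_mul, map_companionSeq, map_companionSeq, companionSeq_eq_pow_add_pow hs hm,
    companionSeq_eq_pow_add_pow hs hm, map_neg, map_pow, map_neg, map_one, ← hm]
  have h1 := root_pow_card_add_one hm hα
  have h2 := root_pow_card_add_one (mul_comm α β ▸ hm) hβ
  rw [← hkl, pow_add] at h1 h2
  have ha : α ^ k ≠ 0 := fun h => by simp [h] at h1
  have hb : β ^ k ≠ 0 := fun h => by simp [h] at h2
  have hone : (α * β) ^ k * (α * β) ^ k = 1 := by rw [← mul_pow, hm]; simp
  rw [mul_pow] at hone ⊢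
  have ea : α ^ l = -(α ^ k * β ^ k) * β ^ k :=
    mul_left_cancel₀ ha (by linear_combination h1 + hone)
  have eb : β ^ l = -(α ^ k * β ^ k) * α ^ k :=
    mul_left_cancel₀ hb (by linear_combination h2 + hone)
  rw [ea, eb]
  ring

theorem companionSeq_middle_sq (hp2 : p ≠ 2) (h5 : ¬ IsSquare (5 : ZMod p)) {m : ℕ}
    (hm2 : 2 * m = p + 1) (hodd : Odd m) : companionSeq (ZMod p) m ^ 2 = -4 := by
  obtain ⟨α, β, hs, hm, hα, hβ⟩ := exists_conjugate_roots hp2 h5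
  apply (algebraMap (ZMod p) (AlgebraicClosure (ZMod p))).injective
  have h1 := root_pow_card_add_one hm hα
  have h2 := root_pow_card_add_one (mul_comm α β ▸ hm) hβ
  have h3 : α ^ m * β ^ m = -1 := by rw [← mul_pow, hm, hodd.neg_one_pow]
  rw [← hm2, mul_comm, pow_mul] at h1 h2
  rw [map_pow, map_companionSeq, companionSeq_eq_pow_add_pow hs hm, map_neg, map_ofNat]
  linear_combination h1 + h2 + 2 * h3

theorem isSquare_of_sq_eq_neg_four {F : Type*} [Field F] (h2 : (2 : F) ≠ 0) {x : F}
    (hx : x ^ 2 = -4) : IsSquare x :=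
  -- `(1 + x/2)² = 1 + x + x²/4 = x`.
  ⟨1 + x / 2, by field_simp; linear_combination -hx⟩

theorem isSquare_prod_companionSeq (h4 : p % 4 = 1) (h5 : ¬ IsSquare (5 : ZMod p)) :
    IsSquare (∏ k ∈ Finset.range (p - 1), companionSeq (ZMod p) (k + 1)) := by
  have hp2 : p ≠ 2 := by omega
  have hneg : IsSquare (-1 : ZMod p) := ZMod.exists_sq_eq_neg_one_iff.mpr (by omega)
  have h20 : (2 : ZMod p) ≠ 0 := Ring.two_ne_zero (by rwa [ZMod.ringChar_zmod_n])
  obtain ⟨t, ht⟩ : ∃ t, p = 4 * (t + 1) + 1 := by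
    have := (Fact.out : p.Prime).two_le
    exact ⟨p / 4 - 1, by omega⟩
  -- `V_1 = -1` is split off; the indices `2, …, p - 1` are symmetric about the odd number `(p + 1)
  -- / 2`.
  rw [show p - 1 = 2 * (2 * t + 1) + 1 + 1 by omega, Finset.prod_range_succ',
    Finset.prod_range_two_mul_add_one]
  refine ((isSquare_finset_prod fun k hk => ?_).mul ?_).mul ?_
  · rw [Finset.mem_range] at hk
    rw [companionSeq_reflect hp2 h5
      (show k + 1 + 1 + (2 * (2 * t + 1) - k + 1 + 1) = p + 1 by omega)]
    have : companionSeq (ZMod p) (k + 1 + 1) *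
        (-(-1) ^ (k + 1 + 1) * companionSeq (ZMod p) (k + 1 + 1)) =
        (-1) * (-1) ^ (k + 1 + 1) *
          (companionSeq (ZMod p) (k + 1 + 1) * companionSeq (ZMod p) (k + 1 + 1)) := by ring
    rw [this]
    exact (hneg.mul (hneg.pow _)).mul ⟨_, rfl⟩
  · refine isSquare_of_sq_eq_neg_four h20 (companionSeq_middle_sq hp2 h5 (by omega) ⟨t + 1, ?_⟩)
    ring
  · simpa [companionSeq] using hneg

end Roots

/-! ### Factorization of the matrix modulo `p`. -/

section Determinant

open Matrix

variable {p : ℕ} [Fact p.Prime]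

theorem ZMod.natCast_fin_add_one_ne_zero (i : Fin (p - 1)) : ((i : ℕ) + 1 : ZMod p) ≠ 0 := by
  intro h
  have h' : (((i : ℕ) + 1 : ℕ) : ZMod p) = 0 := by exact_mod_cast h
  have := Nat.le_of_dvd (by omega) ((ZMod.natCast_eq_zero_iff _ _).mp h')
  omega

theorem ZMod.natCast_fin_add_one_inj {i j : Fin (p - 1)}
    (h : ((i : ℕ) + 1 : ZMod p) = (j : ℕ) + 1) : i = j := by
  have h' : ((i : ℕ) : ZMod p) = (j : ℕ) := add_right_cancel h
  rw [ZMod.natCast_eq_natCast_iff', Nat.mod_eq_of_lt (by omega), Nat.mod_eq_of_lt (by omega)] at h'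
  exact Fin.ext h'

/-- Orthogonality of the power sums makes the matrix product `-1`, of even size `p - 1`. -/
theorem det_invPow_mul_det_pow (hp2 : p ≠ 2) :
    (of fun i k : Fin (p - 1) => (((i : ℕ) + 1 : ZMod p)⁻¹) ^ ((k : ℕ) + 1)).det *
      (of fun k j : Fin (p - 1) => ((j : ℕ) + 1 : ZMod p) ^ ((k : ℕ) + 1)).det = 1 := by
  have heven : Even (p - 1) := (Fact.out : p.Prime).even_sub_one hp2
  have hmul : (of fun i k : Fin (p - 1) => (((i : ℕ) + 1 : ZMod p)⁻¹) ^ ((k : ℕ) + 1)) *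
      (of fun k j : Fin (p - 1) => ((j : ℕ) + 1 : ZMod p) ^ ((k : ℕ) + 1)) = -1 := by
    ext i j
    simp only [mul_apply, of_apply, ← mul_pow, ZMod.sum_pow_succ]
    have hi := ZMod.natCast_fin_add_one_ne_zero i
    have hiff : (((i : ℕ) + 1 : ZMod p)⁻¹ * ((j : ℕ) + 1) = 1) ↔ i = j := by
      rw [inv_mul_eq_one₀ hi]
      exact ⟨ZMod.natCast_fin_add_one_inj, fun h => by rw [h]⟩
    simp only [hiff]
    rw [show (-1 : Matrix (Fin (p - 1)) (Fin (p - 1)) (ZMod p)) i j =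
      -(1 : Matrix (Fin (p - 1)) (Fin (p - 1)) (ZMod p)) i j from rfl, Matrix.one_apply]
    split_ifs <;> simp
  rw [← det_mul, hmul, det_neg, det_one, mul_one, Fintype.card_fin, heven.neg_one_pow]

theorem sunDet_one_neg_one_cast (hp2 : p ≠ 2) (h5 : ¬ IsSquare (5 : ZMod p)) :
    (sunDet p 1 (-1) : ZMod p) =
      (∏ k ∈ Finset.range (p - 1), companionSeq (ZMod p) (k + 1)) *
        (∏ j : Fin (p - 1), (((j : ℕ) + 1 : ZMod p)⁻¹)) ^ 2 := by
  have h50 : (5 : ZMod p) ≠ 0 := fun h => h5 (h ▸ IsSquare.zero)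
  have hp3 : 2 < p := lt_of_le_of_ne (Fact.out : p.Prime).two_le hp2.symm
  have hfac : (of fun i j : Fin (p - 1) => ((((i : ℤ) + 1) ^ 2 + 1 * ((i : ℤ) + 1) * ((j : ℤ) + 1)
        + (-1) * ((j : ℤ) + 1) ^ 2) ^ (p - 2) : ℤ)).map (Int.castRingHom (ZMod p)) =
      (of fun i k : Fin (p - 1) => (((i : ℕ) + 1 : ZMod p)⁻¹) ^ ((k : ℕ) + 1)) *
      diagonal (fun k : Fin (p - 1) => companionSeq (ZMod p) (k + 1) * 5⁻¹) *
      (of fun k j : Fin (p - 1) => ((j : ℕ) + 1 : ZMod p) ^ ((k : ℕ) + 1)) *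
      diagonal (fun j : Fin (p - 1) => (((j : ℕ) + 1 : ZMod p)⁻¹) ^ 2) := by
    ext i j
    rw [mul_diagonal, mul_apply]
    simp only [mul_diagonal, map_apply, of_apply]
    have hi := ZMod.natCast_fin_add_one_ne_zero i
    have hj := ZMod.natCast_fin_add_one_ne_zero j
    have hq := quadForm_ne_zero h5 (i := ((i : ℕ) + 1 : ZMod p)) hj
    have hsum := sum_companionSeq_mul_quadForm hp2 h5 hi ((j : ℕ) + 1 : ZMod p)
    simp only [eq_intCast]
    push_cast
    generalize ((i : ℕ) + 1 : ZMod p) = x at *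
    generalize ((j : ℕ) + 1 : ZMod p) = y at *
    have hS : ∑ k : Fin (p - 1), x⁻¹ ^ ((k : ℕ) + 1) * (companionSeq (ZMod p) (k + 1) * 5⁻¹) *
        y ^ ((k : ℕ) + 1) =
        (∑ k : Fin (p - 1), (y / x) ^ ((k : ℕ) + 1) * companionSeq (ZMod p) (k + 1)) * 5⁻¹ := by
      rw [Finset.sum_mul]
      refine Finset.sum_congr rfl fun k _ => ?_
      rw [div_eq_mul_inv, mul_pow]
      ring
    rw [hS, eq_div_of_mul_eq hq hsum]
    -- Fermat's little theorem turns the exponent `p - 2` into an inverse.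
    have hfl := ZMod.pow_card_sub_one_eq_one hq
    rw [show p - 1 = p - 2 + 1 by omega, pow_succ] at hfl
    rw [show x ^ 2 + 1 * x * y + -1 * y ^ 2 = x ^ 2 + x * y - y ^ 2 by ring,
      eq_inv_of_mul_eq_one_left hfl]
    field_simp
  have h5pow : ∏ _k : Fin (p - 1), (5 : ZMod p)⁻¹ = 1 := by
    rw [Finset.prod_const, Finset.card_univ, Fintype.card_fin, inv_pow,
      ZMod.pow_card_sub_one_eq_one h50, inv_one]
  have hcast : (sunDet p 1 (-1) : ZMod p) = Int.castRingHom (ZMod p) (sunDet p 1 (-1)) := rfl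
  rw [hcast, sunDet, RingHom.map_det, RingHom.mapMatrix_apply, hfac, det_mul, det_mul, det_mul,
    det_diagonal, det_diagonal, Finset.prod_mul_distrib, h5pow, Finset.prod_pow,
    Fin.prod_univ_eq_prod_range (fun k => companionSeq (ZMod p) (k + 1))]
  linear_combination (∏ k ∈ Finset.range (p - 1), companionSeq (ZMod p) (k + 1)) *
    (∏ j : Fin (p - 1), (((j : ℕ) + 1 : ZMod p)⁻¹)) ^ 2 * det_invPow_mul_det_pow hp2

end Determinant

theorem mainTheorem4 (p : ℕ) [Fact p.Prime] (h4 : (p : ℤ) ≡ 1 [ZMOD 4])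
    (h5 : (p : ℤ) ≡ 2 [ZMOD 5] ∨ (p : ℤ) ≡ -2 [ZMOD 5]) :
    legendreSym p (sunDet p 1 (-1)) = 1 := by
  have h4' : p % 4 = 1 := by
    unfold Int.ModEq at h4
    omega
  have h5' : p % 5 = 2 ∨ p % 5 = 3 := by
    unfold Int.ModEq at h5
    omega
  have hp2 : p ≠ 2 := by omega
  have hns := ZMod.not_isSquare_five h4' h5'
  have hcast := sunDet_one_neg_one_cast hp2 hns
  have hne : (sunDet p 1 (-1) : ZMod p) ≠ 0 := by
    rw [hcast]
    exact mul_ne_zero (Finset.prod_ne_zero_iff.mpr fun k _ => companionSeq_ne_zero h4' hns _)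
      (pow_ne_zero _ (Finset.prod_ne_zero_iff.mpr fun j _ =>
        inv_ne_zero (ZMod.natCast_fin_add_one_ne_zero j)))
  rw [legendreSym.eq_one_iff p hne, hcast]
  exact (isSquare_prod_companionSeq h4' hns).mul ⟨_, sq _⟩
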